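/- Consider a stochastic bandit with $K\ge 1$ arms whose mean rewards $\mu^\star_1,\dots,\mu^\star_K$ are drawn independently from the standard normal distribution $\mathcal N(0,1)$; given $\mu^\star$, each time arm $a$ is played it yields an independent reward distributed as $\mathcal N(\mu^\star_a,1)$. Let $f:\mathbb R\to(0,\infty)$ be an arbitrary measurable (merit) function, and for $\mu\in\mathbb R^K$ let $\pi_\mu(a)=f(\mu_a)/\sum_{a'}f(\mu_{a'})$; the optimal fair policy is $\pi^\star=\pi_{\mu^\star}$. The algorithm FairX-TS samples, in each round $t=1,2,\dots$, a parameter $\mu_t$ from the posterior distribution of $\mu^\star$ given the history (policies, arms and rewards) of the first $t-1$ rounds, deploys the policy $\pi_t=\pi_{\mu_t}$, samples an arm $a_t\sim\pi_t$ and observes the reward of $a_t$. Its Bayesian reward regret at round $T$ is $$\mathrm{BayesRR}_T=\mathbb E_{\mu^\star}\left[\mathbb E\left[\sum_{t=1}^T\sum_{a=1}^K\left(\pi^\star(a)-\pi_t(a)\right)\mu^\star_a\;\middle|\;\mu^\star\right]\right].$$ Then $\mathrm{BayesRR}_T=\widetilde O(\sqrt{KT})$ for every $T\ge 1$: there are universal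 constants $C>0$ and $p\in\mathbb N$, independent of $K$, $T$ and $f$, such that for all $K,T\ge1$ and all such $f$ the regret is integrable and $$\left|\mathrm{BayesRR}_T\right|\le C\,\sqrt{KT}\,\left(1+\log(KT)\right)^p .$$ -/

import Mathlib

open MeasureTheory ProbabilityTheory

noncomputable section

namespace FairX

/-- Mean-reward parameters `μ ∈ ℝ^K`, one mean for each of the `K` arms. -/
abbrev Params (K : ℕ) : Type := Fin K → ℝ

/-- What is recorded in one round: the deployed policy (a vector of arm probabilities), the arm
that was drawn from it, and the observed reward. -/
abbrev Round (K : ℕ) : Type := (Fin K → ℝ) × Fin K × ℝ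

/-- A history of `t` rounds (the first round has index `0`). -/
abbrev History (K t : ℕ) : Type := Fin t → Round K

/-- The fair policy for merit function `f` and parameter `θ`: each arm is played with probability
proportional to its merit. For the true parameter it is the optimal fair policy. -/
def fairPolicy {K : ℕ} (f : ℝ → ℝ) (θ : Params K) (a : Fin K) : ℝ :=
  f (θ a) / ∑ a', f (θ a')

lemma measurable_fairPolicy {K : ℕ} {f : ℝ → ℝ} (hf : Measurable f) :
    Measurable (fairPolicy f : Params K → Fin K → ℝ) := by
  unfold fairPolicy
  fun_prop

/-- The prior: the means of the arms are independent standard normal variables. -/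
def prior (K : ℕ) : Measure (Params K) := Measure.pi fun _ => gaussianReal 0 1

instance (K : ℕ) : IsProbabilityMeasure (prior K) := by
  unfold prior; infer_instance

/-- Given `θ`, draw an arm from the fair policy of `θ`. -/
def armKernel (K : ℕ) (f : ℝ → ℝ) (hf : Measurable f) : Kernel (Params K) (Fin K) where
  toFun θ := ∑ a, ENNReal.ofReal (fairPolicy f θ a) • Measure.dirac a
  measurable' := by
    refine Measure.measurable_of_measurable_coe _ fun s hs => ?_
    simp only [Measure.coe_finsetSum, Finset.sum_apply, Measure.smul_apply, smul_eq_mul]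
    refine Finset.measurable_sum _ fun a _ => Measurable.mul_const ?_ _
    exact ENNReal.measurable_ofReal.comp ((measurable_pi_apply a).comp (measurable_fairPolicy hf))

lemma isMarkovKernel_armKernel (K : ℕ) [NeZero K] (f : ℝ → ℝ) (hf : Measurable f)
    (hpos : ∀ x, 0 < f x) : IsMarkovKernel (armKernel K f hf) := by
  refine ⟨fun θ => ⟨?_⟩⟩
  have hS : 0 < ∑ a', f (θ a') := Finset.sum_pos (fun a _ => hpos _) Finset.univ_nonempty
  change (∑ a, ENNReal.ofReal (fairPolicy f θ a) • Measure.dirac a : Measure (Fin K)) Set.univ = 1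
  simp only [Measure.coe_finsetSum, Finset.sum_apply, Measure.smul_apply, smul_eq_mul,
    measure_univ, mul_one]
  rw [← ENNReal.ofReal_sum_of_nonneg (f := fun a => fairPolicy f θ a)
    (fun a _ => (div_pos (hpos _) hS).le)]
  simp only [fairPolicy]
  rw [← Finset.sum_div, div_self hS.ne', ENNReal.ofReal_one]

/-- Given the true means `μ` and the played arm `a`, draw the reward from `N(μ a, 1)`. -/
def rewardKernel (K : ℕ) : Kernel (Params K × Fin K) ℝ where
  toFun p := gaussianReal (p.1 p.2) 1
  measurable' := by
    have h : Measurable fun p : Params K × Fin K => p.1 p.2 :=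
      measurable_from_prod_countable_left fun a => measurable_pi_apply a
    exact measurable_gaussianReal.comp (h.prodMk measurable_const)

instance (K : ℕ) : IsMarkovKernel (rewardKernel K) :=
  ⟨fun p => inferInstanceAs (IsProbabilityMeasure (gaussianReal (p.1 p.2) 1))⟩

/-- One round of Thompson sampling. Given the true means `μ` and the past `h`: sample
`θ ∼ V h`, sample an arm from the fair policy of `θ`, and observe the reward of that arm. The
triple (deployed policy, arm, reward) is recorded. -/
def roundKernel (K t : ℕ) (f : ℝ → ℝ) (hf : Measurable f) (V : Kernel (History K t) (Params K)) :
    Kernel (Params K × History K t) (Round K) :=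
  ((V.comap Prod.snd measurable_snd
      ⊗ₖ (armKernel K f hf).comap Prod.snd measurable_snd)
      ⊗ₖ (rewardKernel K).comap
          (fun p : (Params K × History K t) × (Params K × Fin K) => (p.1.1, p.2.2))
          (by fun_prop)).map
    fun q => (fairPolicy f q.1.1, q.1.2, q.2)

lemma isMarkovKernel_roundKernel (K t : ℕ) [NeZero K] (f : ℝ → ℝ) (hf : Measurable f)
    (hpos : ∀ x, 0 < f x) (V : Kernel (History K t) (Params K)) [IsMarkovKernel V] :
    IsMarkovKernel (roundKernel K t f hf V) := by
  have := isMarkovKernel_armKernel K f hf hpos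
  unfold roundKernel
  refine Kernel.IsMarkovKernel.map _ ?_
  have := measurable_fairPolicy (K := K) hf
  fun_prop

lemma measurable_snoc (K t : ℕ) :
    Measurable fun p : History K t × Round K => (Fin.snoc p.1 p.2 : History K (t + 1)) := by
  refine measurable_pi_iff.2 fun i => ?_
  induction i using Fin.lastCases with
  | last => simpa using measurable_snd
  | cast i => simp only [Fin.snoc_castSucc]; fun_prop

/-- The law of the first `t` rounds of the algorithm given the true means, together with the fact
that it is a Markov kernel. In round `t + 1`, the parameter is sampled from the posterior
distribution of the true means given the first `t` rounds. -/
def historyAux (K : ℕ) [NeZero K] (f : ℝ → ℝ) (hf : Measurable f) (hpos : ∀ x, 0 < f x) :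
    (t : ℕ) → {κ : Kernel (Params K) (History K t) // IsMarkovKernel κ}
  | 0 => ⟨Kernel.const _ (Measure.dirac Fin.elim0), inferInstance⟩
  | t + 1 =>
    let κ := (historyAux K f hf hpos t).1
    haveI : IsMarkovKernel κ := (historyAux K f hf hpos t).2
    ⟨(κ ⊗ₖ roundKernel K t f hf (posterior κ (prior K))).map fun p => Fin.snoc p.1 p.2,
      haveI := isMarkovKernel_roundKernel K t f hf hpos (posterior κ (prior K))
      Kernel.IsMarkovKernel.map _ (measurable_snoc K t)⟩

/-- The law of the first `t` rounds of FairX-TS, as a kernel in the true means. -/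
def historyKernel (K : ℕ) [NeZero K] (f : ℝ → ℝ) (hf : Measurable f) (hpos : ∀ x, 0 < f x)
    (t : ℕ) : Kernel (Params K) (History K t) :=
  (historyAux K f hf hpos t).1

instance (K : ℕ) [NeZero K] (f : ℝ → ℝ) (hf : Measurable f) (hpos : ∀ x, 0 < f x) (t : ℕ) :
    IsMarkovKernel (historyKernel K f hf hpos t) :=
  (historyAux K f hf hpos t).2

/-- The recursion that defines the law of the interaction. -/
lemma historyKernel_succ (K : ℕ) [NeZero K] (f : ℝ → ℝ) (hf : Measurable f)
    (hpos : ∀ x, 0 < f x) (t : ℕ) :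
    historyKernel K f hf hpos (t + 1) =
      (historyKernel K f hf hpos t ⊗ₖ
        roundKernel K t f hf (posterior (historyKernel K f hf hpos t) (prior K))).map
          fun p => Fin.snoc p.1 p.2 := rfl

/-- The reward regret after `T` rounds against the optimal fair policy, for true means `μ`. -/
def rewardRegret {K T : ℕ} (f : ℝ → ℝ) (μ : Params K) (h : History K T) : ℝ :=
  (∑ _t : Fin T, ∑ a, fairPolicy f μ a * μ a) - ∑ t : Fin T, ∑ a, (h t).1 a * μ a

/-- The Bayesian reward regret of FairX-TS after `T` rounds: the expectation, over the true means
drawn from the prior, of the expected reward regret given these means. -/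
def bayesRewardRegret (K : ℕ) [NeZero K] (f : ℝ → ℝ) (hf : Measurable f) (hpos : ∀ x, 0 < f x)
    (T : ℕ) : ℝ :=
  ∫ μ, ∫ h, rewardRegret f μ h ∂(historyKernel K f hf hpos T μ) ∂(prior K)

end FairX

end

open MeasureTheory ProbabilityTheory
open scoped ENNReal

noncomputable section

namespace FairX

/-! Write `m` for `posteriorMean` and `n` for `pulls`. Given the history, the posterior sample has
the same law as the true means, so the weighted sums of `m` under the optimal and the deployed
policy have equal expectations. The expected regret of a round is therefore that of `∑ a, (π⋆ a - π
a) * (μ a - m a)`, and only estimation errors matter.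

No description of the posterior beyond this matching is needed. Policies and arms depend on the true
means only through the history, so the joint law of means and history has density `likelihood`
relative to the prior times the history law at means `0` (`lintegral_historyKernel_eq_likelihood`).
For a fixed history, completing the square arm by arm gives `exp (deviation / 4)` the mean `√2`,
although `n` is random (`lintegral_exp_deviation`).

AM-GM with a free `η` splits each error into a deviation and a bonus `1 / (1 + n a)`. All deviations
are bounded at once at the price of `log K` (`sum_mul_abs_sub_posteriorMean_le`). By matching again,
the mean bonus under either policy is that of the arm actually played, which the increments of `∑ a,
log (1 + n a)` pay for (`integral_potential_succ_ge`). The total is of order `η T (1 + log K) + K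
log (1 + T) / η`, balanced at `η = √(K / T)`. -/

variable {K t : ℕ} {f : ℝ → ℝ}

/-! ### Sufficient statistics and the likelihood ratio -/

/-- The number of times the arm `a` was played. -/
def pulls (h : History K t) (a : Fin K) : ℝ := ∑ s, if (h s).2.1 = a then 1 else 0

/-- The total reward collected from the arm `a`. -/
def rewardSum (h : History K t) (a : Fin K) : ℝ := ∑ s, if (h s).2.1 = a then (h s).2.2 else 0

lemma measurableSet_arm_eq (s : Fin t) (a : Fin K) :
    MeasurableSet {h : History K t | (h s).2.1 = a} := by
  have : Measurable fun h : History K t => (h s).2.1 := by fun_prop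
  exact this (measurableSet_singleton a)

@[fun_prop]
lemma measurable_pulls (a : Fin K) : Measurable fun h : History K t => pulls h a :=
  Finset.measurable_sum _ fun s _ =>
    Measurable.ite (measurableSet_arm_eq s a) measurable_const measurable_const

@[fun_prop]
lemma measurable_rewardSum (a : Fin K) : Measurable fun h : History K t => rewardSum h a :=
  Finset.measurable_sum _ fun s _ =>
    Measurable.ite (measurableSet_arm_eq s a) (by fun_prop) measurable_const

lemma pulls_snoc (h : History K t) (r : Round K) (a : Fin K) :
    pulls (Fin.snoc h r : History K (t + 1)) a = pulls h a + if r.2.1 = a then 1 else 0 := by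
  unfold pulls
  rw [Fin.sum_univ_castSucc]
  simp only [Fin.snoc_castSucc, Fin.snoc_last]

lemma rewardSum_snoc (h : History K t) (r : Round K) (a : Fin K) :
    rewardSum (Fin.snoc h r : History K (t + 1)) a =
      rewardSum h a + if r.2.1 = a then r.2.2 else 0 := by
  simp [rewardSum, Fin.sum_univ_castSucc]

lemma pulls_nonneg (h : History K t) (a : Fin K) : 0 ≤ pulls h a :=
  Finset.sum_nonneg fun _ _ => by split_ifs <;> simp

lemma pulls_le (h : History K t) (a : Fin K) : pulls h a ≤ t := by
  refine (Finset.sum_le_card_nsmul _ _ 1 fun s _ => ?_).trans_eq (by simp)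
  split_ifs <;> simp

/-- The likelihood ratio of the history `h` between the means `μ` and the means `0`. -/
def likelihood (μ : Params K) (h : History K t) : ℝ :=
  ∏ a, Real.exp (rewardSum h a * μ a - pulls h a * μ a ^ 2 / 2)

lemma likelihood_nonneg (μ : Params K) (h : History K t) : 0 ≤ likelihood μ h :=
  Finset.prod_nonneg fun _ _ => (Real.exp_pos _).le

lemma measurable_likelihood :
    Measurable fun p : Params K × History K t => likelihood p.1 p.2 := by
  refine Finset.measurable_prod _ fun a _ => Real.measurable_exp.comp ?_
  have h₁ : Measurable fun p : Params K × History K t => rewardSum p.2 a :=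
    (measurable_rewardSum a).comp measurable_snd
  have h₂ : Measurable fun p : Params K × History K t => pulls p.2 a :=
    (measurable_pulls a).comp measurable_snd
  fun_prop

lemma measurable_likelihood_right (μ : Params K) :
    Measurable (likelihood μ : History K t → ℝ) := by
  refine Finset.measurable_prod _ fun a _ => Real.measurable_exp.comp ?_
  fun_prop

/-- Only the factor of the played arm changes; the new factor is the density of `N(μ a, 1)` relative
to `N(0, 1)` at the reward. -/
lemma likelihood_snoc (μ : Params K) (h : History K t) (r : Round K) :
    likelihood μ (Fin.snoc h r : History K (t + 1)) =
      likelihood μ h * Real.exp (r.2.2 * μ r.2.1 - μ r.2.1 ^ 2 / 2) := by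
  simp only [likelihood, ← Real.exp_sum, ← Real.exp_add, pulls_snoc, rewardSum_snoc]
  congr 1
  rw [← Finset.sum_erase_add _ _ (Finset.mem_univ r.2.1),
    ← Finset.sum_erase_add (a := r.2.1) _ (fun a => rewardSum h a * μ a - pulls h a * μ a ^ 2 / 2)
      (Finset.mem_univ r.2.1)]
  rw [Finset.sum_congr rfl (g := fun a => rewardSum h a * μ a - pulls h a * μ a ^ 2 / 2)]
  · simp; ring
  · intro a ha
    simp [(Finset.ne_of_mem_erase ha).symm]

/-! ### Change of measure to the means `0` -/

lemma lintegral_gaussianReal_eq_tilt (m : ℝ) {F : ℝ → ℝ≥0∞} (hF : Measurable F) :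
    ∫⁻ y, F y ∂gaussianReal m 1 =
      ∫⁻ y, F y * ENNReal.ofReal (Real.exp (y * m - m ^ 2 / 2)) ∂gaussianReal 0 1 := by
  rw [gaussianReal_of_var_ne_zero _ one_ne_zero, gaussianReal_of_var_ne_zero _ one_ne_zero,
    lintegral_withDensity_eq_lintegral_mul _ (measurable_gaussianPDF _ _) hF,
    lintegral_withDensity_eq_lintegral_mul _ (measurable_gaussianPDF _ _) (by fun_prop)]
  congr 1 with y
  simp only [Pi.mul_apply, gaussianPDF]
  rw [mul_comm (F y), ← mul_assoc, ← ENNReal.ofReal_mul (gaussianPDFReal_nonneg _ _ _)]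
  congr 2
  simp only [gaussianPDFReal]
  rw [mul_assoc _ (Real.exp _), ← Real.exp_add]
  congr 2
  simp; ring

lemma fairPolicy_nonneg (hpos : ∀ x, 0 < f x) (θ : Params K) (a : Fin K) : 0 ≤ fairPolicy f θ a :=
  div_nonneg (hpos _).le (Finset.sum_nonneg fun _ _ => (hpos _).le)

lemma sum_fairPolicy (hpos : ∀ x, 0 < f x) [NeZero K] (θ : Params K) :
    ∑ a, fairPolicy f θ a = 1 := by
  have hS : 0 < ∑ a', f (θ a') := Finset.sum_pos (fun a _ => hpos _) Finset.univ_nonempty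
  simp only [fairPolicy]
  rw [← Finset.sum_div, div_self hS.ne']

lemma fairPolicy_le_one (hpos : ∀ x, 0 < f x) [NeZero K] (θ : Params K) (a : Fin K) :
    fairPolicy f θ a ≤ 1 :=
  (Finset.single_le_sum (fun b _ => fairPolicy_nonneg hpos θ b) (Finset.mem_univ a)).trans_eq
    (sum_fairPolicy hpos θ)

lemma lintegral_armKernel (hf : Measurable f) (θ : Params K) (G : Fin K → ℝ≥0∞) :
    ∫⁻ a, G a ∂armKernel K f hf θ = ∑ a, ENNReal.ofReal (fairPolicy f θ a) * G a := by
  change ∫⁻ a, G a ∂(∑ a, ENNReal.ofReal (fairPolicy f θ a) • Measure.dirac a) = _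
  simp [lintegral_finsetSum_measure, lintegral_smul_measure]

lemma lintegral_roundKernel [NeZero K] (hf : Measurable f) (hpos : ∀ x, 0 < f x)
    (V : Kernel (History K t) (Params K)) [IsMarkovKernel V]
    (μ : Params K) (h : History K t) {G : Round K → ℝ≥0∞} (hG : Measurable G) :
    ∫⁻ r, G r ∂roundKernel K t f hf V (μ, h) =
      ∫⁻ θ, ∑ a, ENNReal.ofReal (fairPolicy f θ a) *
        ∫⁻ y, G (fairPolicy f θ, a, y) ∂gaussianReal (μ a) 1 ∂V h := by
  have := isMarkovKernel_armKernel K f hf hpos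
  have hm := measurable_fairPolicy (K := K) hf
  unfold roundKernel
  rw [Kernel.lintegral_map _ (by fun_prop) _ hG, Kernel.lintegral_compProd _ _ _ (by fun_prop),
    Kernel.lintegral_compProd]
  · simp only [Kernel.comap_apply, lintegral_armKernel]
    rfl
  · refine Measurable.lintegral_kernel_prod_right' (κ := ((rewardKernel K).comap
          (fun p : (Params K × History K t) × (Params K × Fin K) => (p.1.1, p.2.2))
          (by fun_prop)).comap (fun p : Params K × Fin K => ((μ, h), p)) (by fun_prop))
          (f := fun p => G (fairPolicy f p.1.1, p.1.2, p.2)) (by fun_prop)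

lemma lintegral_historyKernel_succ [NeZero K] (hf : Measurable f) (hpos : ∀ x, 0 < f x)
    (μ : Params K) {g : History K (t + 1) → ℝ≥0∞}
    (hg : Measurable g) :
    ∫⁻ h, g h ∂historyKernel K f hf hpos (t + 1) μ =
      ∫⁻ h, ∫⁻ r, g (Fin.snoc h r) ∂roundKernel K t f hf
        (posterior (historyKernel K f hf hpos t) (prior K)) (μ, h)
        ∂historyKernel K f hf hpos t μ := by
  have := isMarkovKernel_roundKernel K t f hf hpos
    (posterior (historyKernel K f hf hpos t) (prior K))
  have hm := measurable_snoc K t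
  rw [historyKernel_succ, Kernel.lintegral_map _ hm _ hg,
    Kernel.lintegral_compProd _ _ _ (by fun_prop)]

/-- The posterior kernel is a function of the history alone, so the law of the sampled parameter and
of the arm is the same for `μ` and for `0`. Each round contributes only its reward density, and
neither `f` nor the policies enter the ratio. -/
lemma lintegral_historyKernel_eq_likelihood [NeZero K] (hf : Measurable f) (hpos : ∀ x, 0 < f x)
    (μ : Params K) {g : History K t → ℝ≥0∞}
    (hg : Measurable g) :
    ∫⁻ h, g h ∂historyKernel K f hf hpos t μ =
      ∫⁻ h, g h * ENNReal.ofReal (likelihood μ h) ∂historyKernel K f hf hpos t 0 := by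
  have hl (s : ℕ) := measurable_likelihood_right (t := s) μ
  induction t with
  | zero =>
    change ∫⁻ h, g h ∂(Measure.dirac _) = ∫⁻ h, g h * _ ∂(Measure.dirac _)
    rw [lintegral_dirac' _ hg, lintegral_dirac' _ (by fun_prop)]
    simp [likelihood, pulls, rewardSum]
  | succ t ih =>
    have hr := isMarkovKernel_roundKernel K t f hf hpos
      (posterior (historyKernel K f hf hpos t) (prior K))
    have hm := measurable_snoc K t
    have hp := measurable_fairPolicy (K := K) hf
    rw [lintegral_historyKernel_succ hf hpos μ hg,
      lintegral_historyKernel_succ hf hpos 0 (by fun_prop), ih]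
    · congr 1 with h
      rw [lintegral_roundKernel hf hpos _ _ _ (by fun_prop),
        lintegral_roundKernel hf hpos _ _ _ (by fun_prop), ← lintegral_mul_const'
          _ _ ENNReal.ofReal_ne_top]
      congr 1 with θ
      rw [Finset.sum_mul]
      refine Finset.sum_congr rfl fun a _ => ?_
      rw [mul_assoc, lintegral_gaussianReal_eq_tilt _ (by fun_prop),
        ← lintegral_mul_const' _ _ ENNReal.ofReal_ne_top]
      congr 2 with y
      simp only [likelihood_snoc]
      rw [ENNReal.ofReal_mul (likelihood_nonneg _ _), mul_assoc, mul_comm (ENNReal.ofReal _)]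
    · exact Measurable.lintegral_kernel_prod_right' (κ := (roundKernel K t f hf
        (posterior (historyKernel K f hf hpos t) (prior K))).comap (fun h => (μ, h))
          (by fun_prop)) (f := fun p => g (Fin.snoc p.1 p.2)) (by fun_prop)

/-! ### One-dimensional Gaussian integrals -/

/-- Completing the square: prior and likelihood together have precision `1 + n` and centre `s / (1 +
n)`. The extra exponential only lowers the coefficient `1 / 2` to `1 / 2 - b`. -/
lemma gaussianPDFReal_mul_exp_tilt {n : ℝ} (hn : 0 ≤ n) (s b x : ℝ) :
    gaussianPDFReal 0 1 x *
        (Real.exp (b * ((1 + n) * (x - s / (1 + n)) ^ 2)) * Real.exp (s * x - n * x ^ 2 / 2)) =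
      (√(2 * Real.pi))⁻¹ * Real.exp (s ^ 2 / (2 * (1 + n))) *
        Real.exp (-((1 / 2 - b) * (1 + n)) * (x - s / (1 + n)) ^ 2) := by
  have : 1 + n ≠ 0 := by positivity
  rw [gaussianPDFReal, mul_assoc, mul_assoc (_)⁻¹, ← Real.exp_add, ← Real.exp_add,
    ← Real.exp_add]
  simp only [NNReal.coe_one, mul_one, sub_zero]
  congr 2
  field_simp
  ring

lemma integrable_exp_tilt {n : ℝ} (hn : 0 ≤ n) (s : ℝ) {b : ℝ} (hb : b < 1 / 2) :
    Integrable (fun x => Real.exp (b * ((1 + n) * (x - s / (1 + n)) ^ 2)) *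
      Real.exp (s * x - n * x ^ 2 / 2)) (gaussianReal 0 1) := by
  have hc : 0 < (1 / 2 - b) * (1 + n) := mul_pos (by linarith) (by linarith)
  rw [gaussianReal_of_var_ne_zero _ one_ne_zero, integrable_withDensity_iff_integrable_smul'
    (measurable_gaussianPDF _ _) (Filter.Eventually.of_forall fun _ => gaussianPDF_lt_top)]
  simp only [toReal_gaussianPDF, smul_eq_mul, gaussianPDFReal_mul_exp_tilt hn]
  exact ((integrable_exp_neg_mul_sq hc).comp_sub_right _).const_mul _

/-- No bound on `b` is needed: for `b ≥ 1 / 2` the integral diverges and both sides take the default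
value `0`. -/
lemma integral_exp_tilt {n : ℝ} (hn : 0 ≤ n) (s b : ℝ) :
    ∫ x, Real.exp (b * ((1 + n) * (x - s / (1 + n)) ^ 2)) *
        Real.exp (s * x - n * x ^ 2 / 2) ∂gaussianReal 0 1 =
      (√(2 * Real.pi))⁻¹ * Real.exp (s ^ 2 / (2 * (1 + n))) *
        √(Real.pi / ((1 / 2 - b) * (1 + n))) := by
  rw [integral_gaussianReal_eq_integral_smul one_ne_zero]
  simp only [smul_eq_mul, gaussianPDFReal_mul_exp_tilt hn]
  rw [integral_const_mul, integral_sub_right_eq_self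
    (fun x => Real.exp (-((1 / 2 - b) * (1 + n)) * x ^ 2)), integral_gaussian]

/-- Passing from `b = 0` to `b = 1 / 4` halves the coefficient of the square, whence a factor `√2`
that depends on neither `n` nor `s`. -/
lemma integral_exp_tilt_quarter {n : ℝ} (hn : 0 ≤ n) (s : ℝ) :
    ∫ x, Real.exp (1 / 4 * ((1 + n) * (x - s / (1 + n)) ^ 2)) *
        Real.exp (s * x - n * x ^ 2 / 2) ∂gaussianReal 0 1 =
      √2 * ∫ x, Real.exp (s * x - n * x ^ 2 / 2) ∂gaussianReal 0 1 := by
  have h₀ := integral_exp_tilt hn s 0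
  simp only [zero_mul, Real.exp_zero, one_mul] at h₀
  rw [integral_exp_tilt hn, h₀, mul_left_comm, ← Real.sqrt_mul (by norm_num)]
  congr 2
  field_simp
  norm_num

/-! ### Deviations from the posterior mean -/

/-- The mean of `μ a` under the Gaussian posterior given the history `h`. -/
def posteriorMean (h : History K t) (a : Fin K) : ℝ := rewardSum h a / (1 + pulls h a)

/-- The squared deviation of `μ a` from its posterior mean, in units of the posterior variance. -/
def deviation (μ : Params K) (h : History K t) (a : Fin K) : ℝ :=
  (1 + pulls h a) * (μ a - posteriorMean h a) ^ 2

@[fun_prop]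
lemma measurable_posteriorMean (a : Fin K) :
    Measurable fun h : History K t => posteriorMean h a := by
  unfold posteriorMean
  fun_prop

lemma measurable_deviation (a : Fin K) :
    Measurable fun p : Params K × History K t => deviation p.1 p.2 a := by
  have h₁ : Measurable fun p : Params K × History K t => pulls p.2 a :=
    (measurable_pulls a).comp measurable_snd
  have h₂ : Measurable fun p : Params K × History K t => posteriorMean p.2 a :=
    (measurable_posteriorMean a).comp measurable_snd
  unfold deviation
  fun_prop

/-- For a fixed history, prior and likelihood both factor over the arms. Only the factor of `a` sees
the exponential, and it gains `√2`. -/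
lemma lintegral_exp_deviation_mul_likelihood (h : History K t) (a : Fin K) :
    ∫⁻ μ, ENNReal.ofReal (Real.exp (1 / 4 * deviation μ h a)) *
        ENNReal.ofReal (likelihood μ h) ∂prior K =
      ENNReal.ofReal (√2) * ∫⁻ μ, ENNReal.ofReal (likelihood μ h) ∂prior K := by
  classical
  let g (b : Fin K) (x : ℝ) : ℝ := Real.exp (rewardSum h b * x - pulls h b * x ^ 2 / 2)
  let d (b : Fin K) (x : ℝ) : ℝ :=
    Real.exp ((if b = a then 1 / 4 else 0) *
      ((1 + pulls h b) * (x - rewardSum h b / (1 + pulls h b)) ^ 2)) * g b x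
  have hd : ∀ μ : Params K, ∏ b, d b (μ b) =
      Real.exp (1 / 4 * deviation μ h a) * likelihood μ h := by
    intro μ
    simp only [d, Finset.prod_mul_distrib]
    congr 1
    rw [Finset.prod_eq_single a (by intro b _ hb; simp [hb]) (by simp)]
    simp [deviation, posteriorMean]
  have hg_int : ∀ b, Integrable (g b) (gaussianReal 0 1) := fun b => by
    have := integrable_exp_tilt (pulls_nonneg h b) (rewardSum h b) (b := 0) (by norm_num)
    simpa using! this
  have hd_int : ∀ b, Integrable (d b) (gaussianReal 0 1) := fun b =>
    integrable_exp_tilt (pulls_nonneg h b) (rewardSum h b) (by split_ifs <;> norm_num)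
  have hd_eq : ∀ b, ∫ x, d b x ∂gaussianReal 0 1 =
      (if b = a then √2 else 1) * ∫ x, g b x ∂gaussianReal 0 1 := by
    intro b
    by_cases hb : b = a
    · simp only [d, hb, if_true]
      exact integral_exp_tilt_quarter (pulls_nonneg h a) (rewardSum h a)
    · simp [d, hb]
  have hprod : ∏ b, ∫ x, d b x ∂gaussianReal 0 1 = √2 * ∏ b, ∫ x, g b x ∂gaussianReal 0 1 := by
    simp only [hd_eq, Finset.prod_mul_distrib]
    simp
  have hg_nonneg : ∀ b x, 0 ≤ g b x := fun b x => (Real.exp_pos _).le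
  have hd_nonneg : ∀ b x, 0 ≤ d b x := fun b x => mul_nonneg (Real.exp_pos _).le (hg_nonneg b x)
  simp only [← ENNReal.ofReal_mul (Real.exp_pos _).le, ← hd]
  unfold prior
  rw [← ofReal_integral_eq_lintegral_ofReal (Integrable.fintype_prod hd_int)
      (Filter.Eventually.of_forall fun μ => Finset.prod_nonneg fun b _ => hd_nonneg b _),
    integral_fintype_prod_eq_prod d, hprod, ENNReal.ofReal_mul (by positivity)]
  congr 1
  rw [← integral_fintype_prod_eq_prod g, ofReal_integral_eq_lintegral_ofReal
    (Integrable.fintype_prod hg_int)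
      (Filter.Eventually.of_forall fun μ => Finset.prod_nonneg fun b _ => hg_nonneg b _)]
  rfl

/-! ### Joint laws and probability matching -/

/-- The joint law of the means and of the first `t` rounds. -/
def jointLaw (K : ℕ) [NeZero K] {f : ℝ → ℝ} (hf : Measurable f) (hpos : ∀ x, 0 < f x) (t : ℕ) :
    Measure (Params K × History K t) :=
  prior K ⊗ₘ historyKernel K f hf hpos t

instance [NeZero K] (hf : Measurable f) (hpos : ∀ x, 0 < f x) (t : ℕ) :
    IsProbabilityMeasure (jointLaw K hf hpos t) := by
  unfold jointLaw; infer_instance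

lemma lintegral_jointLaw_eq_likelihood [NeZero K] (hf : Measurable f) (hpos : ∀ x, 0 < f x)
    {g : Params K × History K t → ℝ≥0∞} (hg : Measurable g) :
    ∫⁻ p, g p ∂jointLaw K hf hpos t =
      ∫⁻ h, ∫⁻ μ, g (μ, h) * ENNReal.ofReal (likelihood μ h) ∂prior K
        ∂historyKernel K f hf hpos t 0 := by
  have hl := measurable_likelihood (K := K) (t := t)
  rw [jointLaw, Measure.lintegral_compProd hg, lintegral_lintegral_swap (by
    simp only [Function.uncurry_def]
    fun_prop)]
  refine lintegral_congr fun μ => ?_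
  exact lintegral_historyKernel_eq_likelihood hf hpos μ (by fun_prop)

/-- Under the joint law, the deviation of each arm has the exponential moment of a chi-squared
variable. -/
lemma lintegral_exp_deviation [NeZero K] (hf : Measurable f) (hpos : ∀ x, 0 < f x) (a : Fin K) :
    ∫⁻ p, ENNReal.ofReal (Real.exp (1 / 4 * deviation p.1 p.2 a)) ∂jointLaw K hf hpos t =
      ENNReal.ofReal (√2) := by
  have hm := measurable_deviation (K := K) (t := t) a
  rw [lintegral_jointLaw_eq_likelihood hf hpos (by fun_prop)]
  simp only [lintegral_exp_deviation_mul_likelihood]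
  rw [lintegral_const_mul']
  · have := lintegral_jointLaw_eq_likelihood (K := K) (t := t) hf hpos
      (measurable_const (a := (1 : ℝ≥0∞)))
    simp only [one_mul, lintegral_const, measure_univ] at this
    rw [← this, mul_one]
  · simp

lemma integrable_exp_deviation [NeZero K] (hf : Measurable f) (hpos : ∀ x, 0 < f x)
    (a : Fin K) :
    Integrable (fun p => Real.exp (1 / 4 * deviation p.1 p.2 a)) (jointLaw K hf hpos t) := by
  have hm := measurable_deviation (K := K) (t := t) a
  refine ⟨by fun_prop, ?_⟩
  rw [hasFiniteIntegral_iff_ofReal (Filter.Eventually.of_forall fun _ => (Real.exp_pos _).le),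
    lintegral_exp_deviation]
  simp

lemma integral_exp_deviation [NeZero K] (hf : Measurable f) (hpos : ∀ x, 0 < f x) (a : Fin K) :
    ∫ p, Real.exp (1 / 4 * deviation p.1 p.2 a) ∂jointLaw K hf hpos t = √2 := by
  have hm := measurable_deviation (K := K) (t := t) a
  rw [integral_eq_lintegral_of_nonneg_ae
    (Filter.Eventually.of_forall fun _ => (Real.exp_pos _).le) (by fun_prop),
    lintegral_exp_deviation, ENNReal.toReal_ofReal (by positivity)]

/-- The posterior distribution of the means given the first `t` rounds. -/
abbrev posteriorKernel (K : ℕ) [NeZero K] {f : ℝ → ℝ} (hf : Measurable f) (hpos : ∀ x, 0 < f x)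
    (t : ℕ) : Kernel (History K t) (Params K) :=
  posterior (historyKernel K f hf hpos t) (prior K)

/-- The joint law of the means, of the first `t` rounds and of the posterior sample of the
following round. -/
def sampleLaw (K : ℕ) [NeZero K] {f : ℝ → ℝ} (hf : Measurable f) (hpos : ∀ x, 0 < f x) (t : ℕ) :
    Measure ((Params K × History K t) × Params K) :=
  jointLaw K hf hpos t ⊗ₘ (posteriorKernel K hf hpos t).comap Prod.snd measurable_snd

/-- The joint law of the means, of the first `t` rounds and of the following round. -/
def roundLaw (K : ℕ) [NeZero K] {f : ℝ → ℝ} (hf : Measurable f) (hpos : ∀ x, 0 < f x) (t : ℕ) :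
    Measure ((Params K × History K t) × Round K) :=
  jointLaw K hf hpos t ⊗ₘ roundKernel K t f hf (posteriorKernel K hf hpos t)

lemma sum_ofReal_fairPolicy [NeZero K] (hpos : ∀ x, 0 < f x) (θ : Params K) :
    ∑ a, ENNReal.ofReal (fairPolicy f θ a) = 1 := by
  rw [← ENNReal.ofReal_sum_of_nonneg fun a _ => fairPolicy_nonneg hpos θ a,
    sum_fairPolicy hpos, ENNReal.ofReal_one]

section

variable [NeZero K] (hf : Measurable f) (hpos : ∀ x, 0 < f x)

instance : IsProbabilityMeasure (sampleLaw K hf hpos t) := by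
  unfold sampleLaw; infer_instance

instance : IsProbabilityMeasure (roundLaw K hf hpos t) := by
  have := isMarkovKernel_roundKernel K t f hf hpos (posteriorKernel K hf hpos t)
  unfold roundLaw; infer_instance

lemma measurePreserving_sampleLaw_fst :
    MeasurePreserving Prod.fst (sampleLaw K hf hpos t) (jointLaw K hf hpos t) :=
  ⟨measurable_fst, Measure.fst_compProd _ _⟩

lemma measurePreserving_roundLaw_fst :
    MeasurePreserving Prod.fst (roundLaw K hf hpos t) (jointLaw K hf hpos t) := by
  have := isMarkovKernel_roundKernel K t f hf hpos (posteriorKernel K hf hpos t)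
  exact ⟨measurable_fst, Measure.fst_compProd _ _⟩

/-- Probability matching: the posterior sample and the true means have the same joint law with the
history. -/
lemma measurePreserving_sampleLaw_sample :
    MeasurePreserving (fun q : (Params K × History K t) × Params K => (q.2, q.1.2))
      (sampleLaw K hf hpos t) (jointLaw K hf hpos t) := by
  refine ⟨by fun_prop, Measure.ext_of_lintegral _ fun g hg => ?_⟩
  rw [lintegral_map hg (by fun_prop), sampleLaw, Measure.lintegral_compProd (by fun_prop)]
  simp only [Kernel.comap_apply]
  have hG : Measurable fun h => ∫⁻ θ, g (θ, h) ∂posteriorKernel K hf hpos t h :=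
    Measurable.lintegral_kernel_prod_right' (f := fun p => g (p.2, p.1)) (by fun_prop)
  have hsnd : (jointLaw K hf hpos t).map Prod.snd = historyKernel K f hf hpos t ∘ₘ prior K :=
    Measure.snd_compProd _ _
  -- The sample depends on the history only, so the joint law may be replaced by its history
  -- marginal; Bayes' rule then swaps the pair.
  rw [← lintegral_map (g := Prod.snd) hG measurable_snd, hsnd,
    ← Measure.lintegral_compProd (f := fun p => g (p.2, p.1)) (by fun_prop),
    compProd_posterior_eq_map_swap, lintegral_map (by fun_prop) measurable_swap]
  rfl

lemma measurePreserving_roundLaw_snoc :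
    MeasurePreserving (fun q : (Params K × History K t) × Round K =>
        (q.1.1, (Fin.snoc q.1.2 q.2 : History K (t + 1))))
      (roundLaw K hf hpos t) (jointLaw K hf hpos (t + 1)) := by
  have hr := isMarkovKernel_roundKernel K t f hf hpos (posteriorKernel K hf hpos t)
  have hs := measurable_snoc K t
  have hm : Measurable fun q : (Params K × History K t) × Round K =>
      (q.1.1, (Fin.snoc q.1.2 q.2 : History K (t + 1))) := by
    refine Measurable.prodMk (by fun_prop) ?_
    exact hs.comp (g := fun p : History K t × Round K => (Fin.snoc p.1 p.2 : History K (t + 1)))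
      (f := fun q : (Params K × History K t) × Round K => (q.1.2, q.2)) (by fun_prop)
  refine ⟨hm, Measure.ext_of_lintegral _ fun g hg => ?_⟩
  have hgm : Measurable fun q : (Params K × History K t) × Round K =>
      g (q.1.1, (Fin.snoc q.1.2 q.2 : History K (t + 1))) := hg.comp hm
  rw [lintegral_map hg hm, roundLaw, Measure.lintegral_compProd hgm, jointLaw,
    Measure.lintegral_compProd, jointLaw, Measure.lintegral_compProd hg]
  · refine lintegral_congr fun μ => ?_
    rw [lintegral_historyKernel_succ hf hpos μ (by fun_prop)]
  · exact Measurable.lintegral_kernel_prod_right' hgm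

lemma lintegral_roundLaw {G : (Params K × History K t) × Round K → ℝ≥0∞} (hG : Measurable G) :
    ∫⁻ q, G q ∂roundLaw K hf hpos t =
      ∫⁻ p, ∫⁻ θ, ∑ a, ENNReal.ofReal (fairPolicy f θ a) *
        ∫⁻ y, G (p, fairPolicy f θ, a, y) ∂gaussianReal (p.1 a) 1
          ∂posteriorKernel K hf hpos t p.2 ∂jointLaw K hf hpos t := by
  have hr := isMarkovKernel_roundKernel K t f hf hpos (posteriorKernel K hf hpos t)
  rw [roundLaw, Measure.lintegral_compProd hG]
  exact lintegral_congr fun p =>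
    lintegral_roundKernel hf hpos (posteriorKernel K hf hpos t) p.1 p.2 (by fun_prop)

/-- The recorded policy is the fair policy of the posterior sample. -/
lemma map_roundLaw_policy :
    (roundLaw K hf hpos t).map (fun q => (q.1, q.2.1)) =
      (sampleLaw K hf hpos t).map (fun q => (q.1, fairPolicy f q.2)) := by
  have hp := measurable_fairPolicy (K := K) hf
  refine Measure.ext_of_lintegral _ fun g hg => ?_
  rw [lintegral_map hg (by fun_prop), lintegral_map hg (by fun_prop),
    lintegral_roundLaw hf hpos (by fun_prop), sampleLaw, Measure.lintegral_compProd (by fun_prop)]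
  simp only [lintegral_const, measure_univ, mul_one, Kernel.comap_apply, ← Finset.sum_mul,
    sum_ofReal_fairPolicy hpos, one_mul]

/-- The arm of a round is drawn from the fair policy of the posterior sample. -/
lemma lintegral_roundLaw_arm {G : Params K × History K t → Fin K → ℝ≥0∞}
    (hG : ∀ a, Measurable fun p => G p a) :
    ∫⁻ q, G q.1 q.2.2.1 ∂roundLaw K hf hpos t =
      ∫⁻ q, ∑ a, ENNReal.ofReal (fairPolicy f q.2 a) * G q.1 a ∂sampleLaw K hf hpos t := by
  have hp := measurable_fairPolicy (K := K) hf
  have hG' : Measurable fun q : (Params K × History K t) × Fin K => G q.1 q.2 :=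
    measurable_from_prod_countable_left hG
  rw [lintegral_roundLaw hf hpos (G := fun q => G q.1 q.2.2.1)
    (hG'.comp (f := fun q : (Params K × History K t) × Round K => (q.1, q.2.2.1))
      (by fun_prop)), sampleLaw, Measure.lintegral_compProd]
  · simp only [lintegral_const, measure_univ, mul_one, Kernel.comap_apply]
  · have (a : Fin K) := hG a
    fun_prop

lemma integrable_abs_mean (a : Fin K) :
    Integrable (fun p : Params K × History K t => |p.1 a|) (jointLaw K hf hpos t) := by
  have h₁ : MeasurePreserving Prod.fst (jointLaw K hf hpos t) (prior K) :=
    ⟨measurable_fst, Measure.fst_compProd _ _⟩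
  have h₂ : MeasurePreserving (Function.eval a) (prior K) (gaussianReal 0 1) :=
    measurePreserving_eval _ a
  have h₃ : Integrable (fun x : ℝ => |x|) (gaussianReal 0 1) :=
    ((memLp_id_gaussianReal 1).integrable (by simp)).abs
  exact (h₂.comp h₁).integrable_comp_of_integrable h₃

end

lemma integral_comp_of_measurePreserving {α β : Type*} [MeasurableSpace α] [MeasurableSpace β]
    {μ : Measure α} {ν : Measure β} {φ : α → β} (hφ : MeasurePreserving φ μ ν) {g : β → ℝ}
    (hg : AEStronglyMeasurable g ν) : ∫ x, g (φ x) ∂μ = ∫ y, g y ∂ν := by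
  rw [← hφ.map_eq] at hg ⊢
  exact (integral_map hφ.measurable.aemeasurable hg).symm

/-! ### Regret of a single round -/

/-- The expected exploration bonus `1 / (1 + pulls)` of the policy `π`. -/
def exploration (π : Fin K → ℝ) (h : History K t) : ℝ := ∑ a, π a / (1 + pulls h a)

/-- The reward regret of the policy `π` in one round. -/
def roundRegret (f : ℝ → ℝ) (μ : Params K) (π : Fin K → ℝ) : ℝ :=
  ∑ a, (fairPolicy f μ a - π a) * μ a

lemma one_add_pulls_pos (h : History K t) (a : Fin K) : 0 < 1 + pulls h a := by
  linarith [pulls_nonneg h a]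

lemma measurable_exploration (hf : Measurable f) :
    Measurable fun p : Params K × History K t => exploration (fairPolicy f p.1) p.2 := by
  have hp := measurable_fairPolicy (K := K) hf
  have h₁ (a : Fin K) : Measurable fun p : Params K × History K t => pulls p.2 a :=
    (measurable_pulls a).comp measurable_snd
  unfold exploration
  fun_prop

lemma exploration_nonneg {π : Fin K → ℝ} (hπ : ∀ a, 0 ≤ π a) (h : History K t) :
    0 ≤ exploration π h :=
  Finset.sum_nonneg fun a _ => div_nonneg (hπ a) (one_add_pulls_pos h a).le

lemma exploration_le_one {π : Fin K → ℝ} (hπ : ∀ a, 0 ≤ π a) (hπ' : ∑ a, π a = 1)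
    (h : History K t) : exploration π h ≤ 1 :=
  (Finset.sum_le_sum fun a _ =>
    div_le_self (hπ a) (by linarith [pulls_nonneg h a])).trans_eq hπ'

lemma integrable_exploration [NeZero K] (hf : Measurable f) (hpos : ∀ x, 0 < f x) :
    Integrable (fun p => exploration (fairPolicy f p.1) p.2) (jointLaw K hf hpos t) := by
  refine Integrable.of_bound (measurable_exploration hf).aestronglyMeasurable 1
    (Filter.Eventually.of_forall fun p => ?_)
  rw [Real.norm_of_nonneg (exploration_nonneg (fairPolicy_nonneg hpos _) _)]
  exact exploration_le_one (fairPolicy_nonneg hpos _) (sum_fairPolicy hpos _) _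

/-- Estimation errors are bounded by their deviation and the exploration bonus. -/
lemma abs_sub_posteriorMean_le {η : ℝ} (hη : 0 < η) (μ : Params K) (h : History K t)
    (a : Fin K) :
    |μ a - posteriorMean h a| ≤
      2 * η * (1 / 4 * deviation μ h a) + 1 / (2 * η) * (1 / (1 + pulls h a)) := by
  have hn := one_add_pulls_pos h a
  -- The slack in AM-GM, written as a square over a positive denominator.
  have key : 2 * η * (1 / 4 * deviation μ h a) + 1 / (2 * η) * (1 / (1 + pulls h a)) -
      |μ a - posteriorMean h a| =
      (η * (1 + pulls h a) * |μ a - posteriorMean h a| - 1) ^ 2 /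
        (2 * η * (1 + pulls h a)) := by
    unfold deviation
    rw [← sq_abs (μ a - posteriorMean h a)]
    field_simp
    ring
  have : 0 ≤ (η * (1 + pulls h a) * |μ a - posteriorMean h a| - 1) ^ 2 /
        (2 * η * (1 + pulls h a)) := by positivity
  linarith

/-- The exponential lies above its tangent at `log k`. With `k = K`, one average of exponentials
dominates every arm's deviation, so `K` enters only through a logarithm. -/
lemma le_log_add_exp_div {k : ℝ} (hk : 0 < k) (y : ℝ) : y ≤ Real.log k + Real.exp y / k := by
  have := Real.add_one_le_exp (y - Real.log k)
  rw [Real.exp_sub, Real.exp_log hk] at this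
  linarith

/-- The average over the arms of the exponential of the deviation. -/
def expDeviation (μ : Params K) (h : History K t) : ℝ :=
  (∑ a, Real.exp (1 / 4 * deviation μ h a)) / K

lemma sum_mul_abs_sub_posteriorMean_le [NeZero K] {η : ℝ} (hη : 0 < η) {π : Fin K → ℝ}
    (hπ : ∀ a, 0 ≤ π a) (hπ' : ∑ a, π a = 1) (μ : Params K) (h : History K t) :
    ∑ a, π a * |μ a - posteriorMean h a| ≤
      2 * η * (Real.log K + expDeviation μ h) + 1 / (2 * η) * exploration π h := by
  have hK : (0 : ℝ) < K := by exact_mod_cast Nat.pos_of_ne_zero (NeZero.ne K)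
  have h₁ : ∀ a, 1 / 4 * deviation μ h a ≤ Real.log K + expDeviation μ h := fun a => by
    refine (le_log_add_exp_div hK _).trans (add_le_add_right ?_ _)
    refine div_le_div_of_nonneg_right ?_ hK.le
    exact Finset.single_le_sum (f := fun a => Real.exp (1 / 4 * deviation μ h a))
      (fun _ _ => (Real.exp_pos _).le) (Finset.mem_univ a)
  calc ∑ a, π a * |μ a - posteriorMean h a|
      ≤ ∑ a, π a * (2 * η * (Real.log K + expDeviation μ h) +
          1 / (2 * η) * (1 / (1 + pulls h a))) := by
        refine Finset.sum_le_sum fun a _ => mul_le_mul_of_nonneg_left ?_ (hπ a)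
        refine (abs_sub_posteriorMean_le hη μ h a).trans (add_le_add_left ?_ _)
        exact mul_le_mul_of_nonneg_left (h₁ a) (by positivity)
    _ = _ := by
        simp only [mul_add, Finset.sum_add_distrib, ← Finset.sum_mul, hπ', exploration,
          Finset.mul_sum]
        rw [one_mul, one_mul]
        congr 1
        exact Finset.sum_congr rfl fun a _ => by ring

/-- The estimation error that enters the regret of one round. -/
def errorTerm (f : ℝ → ℝ) (q : (Params K × History K t) × Params K) : ℝ :=
  ∑ a, (fairPolicy f q.1.1 a - fairPolicy f q.2 a) * (q.1.1 a - posteriorMean q.1.2 a)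

/-- The bracket has mean zero by probability matching. -/
lemma roundRegret_eq (q : (Params K × History K t) × Params K) :
    roundRegret f q.1.1 (fairPolicy f q.2) = errorTerm f q +
      (∑ a, fairPolicy f q.1.1 a * posteriorMean q.1.2 a -
        ∑ a, fairPolicy f q.2 a * posteriorMean q.1.2 a) := by
  simp only [roundRegret, errorTerm, ← Finset.sum_sub_distrib, ← Finset.sum_add_distrib]
  exact Finset.sum_congr rfl fun a _ => by ring

section

variable [NeZero K] (hf : Measurable f) (hpos : ∀ x, 0 < f x)

lemma integrable_expDeviation :
    Integrable (fun p => expDeviation p.1 p.2) (jointLaw K hf hpos t) :=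
  (integrable_finsetSum _ fun a _ => integrable_exp_deviation hf hpos a).div_const _

lemma integral_expDeviation :
    ∫ p, expDeviation p.1 p.2 ∂jointLaw K hf hpos t = √2 := by
  have hK : (K : ℝ) ≠ 0 := by exact_mod_cast NeZero.ne K
  unfold expDeviation
  rw [integral_div, integral_finsetSum _ fun a _ => integrable_exp_deviation hf hpos a]
  simp only [integral_exp_deviation]
  simp [hK]

lemma integrable_posteriorMean (a : Fin K) :
    Integrable (fun p : Params K × History K t => posteriorMean p.2 a)
      (jointLaw K hf hpos t) := by
  have hm : Measurable fun p : Params K × History K t => posteriorMean p.2 a :=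
    (measurable_posteriorMean a).comp measurable_snd
  refine ((integrable_abs_mean hf hpos a).add
    (((integrable_exp_deviation hf hpos a).const_mul 2).add (integrable_const 1))).mono'
      hm.aestronglyMeasurable (Filter.Eventually.of_forall fun p => ?_)
  -- Any fixed `η` serves for integrability; `η = 1` is taken.
  have h₁ := abs_sub_posteriorMean_le one_pos p.1 p.2 a
  have h₂ := Real.add_one_le_exp (1 / 4 * deviation p.1 p.2 a)
  have h₃ : 1 / (1 + pulls p.2 a) ≤ 1 :=
    div_le_self zero_le_one (by linarith [pulls_nonneg p.2 a])
  have h₄ := abs_sub_abs_le_abs_sub (posteriorMean p.2 a) (p.1 a)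
  rw [abs_sub_comm] at h₄
  simp only [Pi.add_apply, Real.norm_eq_abs]
  linarith

lemma integrable_fairPolicy_mul_posteriorMean :
    Integrable (fun p : Params K × History K t => ∑ a, fairPolicy f p.1 a * posteriorMean p.2 a)
      (jointLaw K hf hpos t) := by
  have hp := measurable_fairPolicy (K := K) hf
  refine integrable_finsetSum _ fun a _ => (integrable_posteriorMean hf hpos a).bdd_mul (c := 1)
    (Measurable.aestronglyMeasurable (by fun_prop)) (Filter.Eventually.of_forall fun p => ?_)
  rw [Real.norm_of_nonneg (fairPolicy_nonneg hpos _ _)]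
  exact fairPolicy_le_one hpos _ _

lemma abs_errorTerm_le (hpos : ∀ x, 0 < f x) {η : ℝ} (hη : 0 < η)
    (q : (Params K × History K t) × Params K) :
    |errorTerm f q| ≤ 4 * η * (Real.log K + expDeviation q.1.1 q.1.2) +
      1 / (2 * η) * (exploration (fairPolicy f q.1.1) q.1.2 +
        exploration (fairPolicy f q.2) q.1.2) := by
  have h₁ := sum_mul_abs_sub_posteriorMean_le hη (fairPolicy_nonneg hpos q.1.1)
    (sum_fairPolicy hpos _) q.1.1 q.1.2
  have h₂ := sum_mul_abs_sub_posteriorMean_le hη (fairPolicy_nonneg hpos q.2)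
    (sum_fairPolicy hpos _) q.1.1 q.1.2
  have h₃ : |errorTerm f q| ≤
      ∑ a, fairPolicy f q.1.1 a * |q.1.1 a - posteriorMean q.1.2 a| +
      ∑ a, fairPolicy f q.2 a * |q.1.1 a - posteriorMean q.1.2 a| := by
    rw [← Finset.sum_add_distrib]
    refine (Finset.abs_sum_le_sum_abs _ _).trans (Finset.sum_le_sum fun a _ => ?_)
    rw [abs_mul, ← add_mul]
    refine mul_le_mul_of_nonneg_right ((abs_sub _ _).trans_eq ?_) (abs_nonneg _)
    rw [abs_of_nonneg (fairPolicy_nonneg hpos _ _), abs_of_nonneg (fairPolicy_nonneg hpos _ _)]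
  linarith

lemma integrable_errorTerm_bound (η : ℝ) :
    Integrable (fun q : (Params K × History K t) × Params K =>
      4 * η * (Real.log K + expDeviation q.1.1 q.1.2) +
      1 / (2 * η) * (exploration (fairPolicy f q.1.1) q.1.2 +
        exploration (fairPolicy f q.2) q.1.2)) (sampleLaw K hf hpos t) := by
  have h₁ :=
    (measurePreserving_sampleLaw_fst (K := K) (t := t) hf hpos).integrable_comp_of_integrable
    (integrable_expDeviation hf hpos)
  have h₂ :=
    (measurePreserving_sampleLaw_fst (K := K) (t := t) hf hpos).integrable_comp_of_integrable
    (integrable_exploration hf hpos)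
  have h₃ :=
    (measurePreserving_sampleLaw_sample (K := K) (t := t) hf hpos).integrable_comp_of_integrable
    (integrable_exploration hf hpos)
  exact (((integrable_const _).add h₁).const_mul _).add ((h₂.add h₃).const_mul _)

/-- Matching gives both exploration terms the same mean, which turns `1 / (2 * η)` into `1 / η`. -/
lemma integral_errorTerm_bound (η : ℝ) :
    ∫ q, (4 * η * (Real.log K + expDeviation q.1.1 q.1.2) +
      1 / (2 * η) * (exploration (fairPolicy f q.1.1) q.1.2 +
        exploration (fairPolicy f q.2) q.1.2)) ∂sampleLaw K hf hpos t =
      4 * η * (Real.log K + √2) +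
        1 / η * ∫ p, exploration (fairPolicy f p.1) p.2 ∂jointLaw K hf hpos t := by
  have m₁ := measurePreserving_sampleLaw_fst (K := K) (t := t) hf hpos
  have m₂ := measurePreserving_sampleLaw_sample (K := K) (t := t) hf hpos
  have h₁ := m₁.integrable_comp_of_integrable (integrable_expDeviation hf hpos)
  have h₂ := m₁.integrable_comp_of_integrable (integrable_exploration hf hpos)
  have h₃ := m₂.integrable_comp_of_integrable (integrable_exploration hf hpos)
  have e₁ := integral_comp_of_measurePreserving m₁
    (integrable_expDeviation hf hpos).aestronglyMeasurable
  have e₂ := integral_comp_of_measurePreserving m₁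
    (integrable_exploration hf hpos).aestronglyMeasurable
  have e₃ := integral_comp_of_measurePreserving m₂
    (integrable_exploration hf hpos).aestronglyMeasurable
  simp only [Function.comp_def] at h₁ h₂ h₃
  have h₄ : Integrable (fun q => 4 * η * (Real.log K + expDeviation q.1.1 q.1.2))
      (sampleLaw K hf hpos t) := ((integrable_const _).add h₁).const_mul _
  have h₅ : Integrable (fun q => 1 / (2 * η) * (exploration (fairPolicy f q.1.1) q.1.2 +
      exploration (fairPolicy f q.2) q.1.2)) (sampleLaw K hf hpos t) := (h₂.add h₃).const_mul _
  rw [integral_add h₄ h₅,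
    integral_const_mul, integral_const_mul, integral_add (integrable_const _) h₁,
    integral_add h₂ h₃, e₁, e₂, e₃, integral_expDeviation]
  simp
  ring

lemma integrable_errorTerm :
    Integrable (errorTerm f) (sampleLaw K hf hpos t) := by
  have hp := measurable_fairPolicy (K := K) hf
  have hu (a : Fin K) : Measurable
      fun q : (Params K × History K t) × Params K => posteriorMean q.1.2 a :=
    (measurable_posteriorMean a).comp (measurable_snd.comp measurable_fst)
  refine (integrable_errorTerm_bound hf hpos 1).mono' ?_
    (Filter.Eventually.of_forall fun q => abs_errorTerm_le hpos one_pos q)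
  unfold errorTerm
  fun_prop

lemma integrable_roundRegret :
    Integrable (fun q => roundRegret f q.1.1 (fairPolicy f q.2)) (sampleLaw K hf hpos t) := by
  simp only [roundRegret_eq]
  have hW := integrable_fairPolicy_mul_posteriorMean (K := K) (t := t) hf hpos
  exact (integrable_errorTerm hf hpos).add
    (((measurePreserving_sampleLaw_fst hf hpos).integrable_comp_of_integrable hW).sub
      ((measurePreserving_sampleLaw_sample hf hpos).integrable_comp_of_integrable hW))

/-- By probability matching, the expected regret of one round is its expected estimation error. -/
lemma integral_roundRegret :
    ∫ q, roundRegret f q.1.1 (fairPolicy f q.2) ∂sampleLaw K hf hpos t =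
      ∫ q, errorTerm f q ∂sampleLaw K hf hpos t := by
  have m₁ := measurePreserving_sampleLaw_fst (K := K) (t := t) hf hpos
  have m₂ := measurePreserving_sampleLaw_sample (K := K) (t := t) hf hpos
  have hW := integrable_fairPolicy_mul_posteriorMean (K := K) (t := t) hf hpos
  have h₁ := m₁.integrable_comp_of_integrable hW
  have h₂ := m₂.integrable_comp_of_integrable hW
  have e₁ := integral_comp_of_measurePreserving m₁ hW.aestronglyMeasurable
  have e₂ := integral_comp_of_measurePreserving m₂ hW.aestronglyMeasurable
  simp only [Function.comp_def] at h₁ h₂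
  simp only [roundRegret_eq]
  have h₃ : Integrable (fun q => ∑ a, fairPolicy f q.1.1 a * posteriorMean q.1.2 a -
      ∑ a, fairPolicy f q.2 a * posteriorMean q.1.2 a) (sampleLaw K hf hpos t) := h₁.sub h₂
  rw [integral_add (integrable_errorTerm hf hpos) h₃, integral_sub h₁ h₂, e₁, e₂,
    sub_self, add_zero]

lemma abs_integral_roundRegret_le {η : ℝ} (hη : 0 < η) :
    |∫ q, roundRegret f q.1.1 (fairPolicy f q.2) ∂sampleLaw K hf hpos t| ≤
      4 * η * (Real.log K + √2) +
        1 / η * ∫ p, exploration (fairPolicy f p.1) p.2 ∂jointLaw K hf hpos t := by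
  rw [integral_roundRegret, ← integral_errorTerm_bound hf hpos]
  exact abs_integral_le_integral_abs.trans (integral_mono (integrable_errorTerm hf hpos).abs
    (integrable_errorTerm_bound hf hpos η) fun q => abs_errorTerm_le hpos hη q)

end

/-! ### Logarithmic potential -/

/-- The potential that accounts for the exploration bonuses. -/
def potential (h : History K t) : ℝ := ∑ a, Real.log (1 + pulls h a)

@[fun_prop]
lemma measurable_potential : Measurable fun h : History K t => potential h := by
  unfold potential
  fun_prop

lemma potential_nonneg (h : History K t) : 0 ≤ potential h :=
  Finset.sum_nonneg fun a _ => Real.log_nonneg (by linarith [pulls_nonneg h a])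

lemma potential_le (h : History K t) : potential h ≤ K * Real.log (1 + t) := by
  refine (Finset.sum_le_card_nsmul _ _ (Real.log (1 + t)) fun a _ => ?_).trans_eq (by simp)
  exact Real.log_le_log (one_add_pulls_pos h a) (by linarith [pulls_le h a])

/-- By `log x ≥ 1 - 1 / x`, the right side is at least `1 / (2 + n)`, and `2 + n ≤ 2 * (1 + n)`. -/
lemma half_inv_le_log_sub_log {n : ℝ} (hn : 0 ≤ n) :
    1 / 2 * (1 / (1 + n)) ≤ Real.log (1 + (n + 1)) - Real.log (1 + n) := by
  have h₁ := Real.one_sub_inv_le_log_of_pos (x := (1 + (n + 1)) / (1 + n)) (by positivity)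
  rw [Real.log_div (by positivity) (by positivity)] at h₁
  refine le_trans ?_ h₁
  rw [inv_div, ← sub_nonneg]
  have : 1 - (1 + n) / (1 + (n + 1)) - 1 / 2 * (1 / (1 + n)) =
      n / (2 * (1 + (n + 1)) * (1 + n)) := by
    field_simp
    ring
  rw [this]
  positivity

lemma potential_snoc_ge (h : History K t) (r : Round K) :
    potential h + 1 / 2 * (1 / (1 + pulls h r.2.1)) ≤
      potential (Fin.snoc h r : History K (t + 1)) := by
  have hs : ∑ a, (if r.2.1 = a then 1 / 2 * (1 / (1 + pulls h a)) else 0) =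
      1 / 2 * (1 / (1 + pulls h r.2.1)) := by simp
  rw [← hs, potential, ← Finset.sum_add_distrib]
  refine Finset.sum_le_sum fun a _ => ?_
  rw [pulls_snoc]
  split_ifs
  · linarith [half_inv_le_log_sub_log (pulls_nonneg h a)]
  · simp

lemma rewardRegret_snoc (μ : Params K) (h : History K t) (r : Round K) :
    rewardRegret f μ (Fin.snoc h r : History K (t + 1)) =
      rewardRegret f μ h + roundRegret f μ r.1 := by
  simp only [rewardRegret, roundRegret, Fin.sum_univ_castSucc, Fin.snoc_castSucc, Fin.snoc_last,
    sub_mul, Finset.sum_sub_distrib]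
  ring

lemma measurable_rewardRegret (hf : Measurable f) :
    Measurable fun p : Params K × History K t => rewardRegret f p.1 p.2 := by
  have hp := measurable_fairPolicy (K := K) hf
  unfold rewardRegret
  fun_prop

lemma measurable_roundRegret (hf : Measurable f) :
    Measurable fun p : Params K × (Fin K → ℝ) => roundRegret f p.1 p.2 := by
  have hp := measurable_fairPolicy (K := K) hf
  unfold roundRegret
  fun_prop

lemma measurable_bonus : Measurable fun q : (Params K × History K t) × Round K =>
    1 / (1 + pulls q.1.2 q.2.2.1) := by
  have h : Measurable fun p : History K t × Fin K => 1 / (1 + pulls p.1 p.2) :=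
    measurable_from_prod_countable_left fun a => by
      have := measurable_pulls (K := K) (t := t) a
      dsimp only
      fun_prop
  exact h.comp (f := fun q : (Params K × History K t) × Round K => (q.1.2, q.2.2.1))
    (by fun_prop)

section

variable [NeZero K] (hf : Measurable f) (hpos : ∀ x, 0 < f x)

lemma integrable_potential :
    Integrable (fun p : Params K × History K t => potential p.2) (jointLaw K hf hpos t) := by
  refine Integrable.of_bound (Measurable.aestronglyMeasurable (by fun_prop))
    (K * Real.log (1 + t)) (Filter.Eventually.of_forall fun p => ?_)
  rw [Real.norm_of_nonneg (potential_nonneg _)]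
  exact potential_le _

lemma integrable_bonus :
    Integrable (fun q => 1 / (1 + pulls q.1.2 q.2.2.1)) (roundLaw K hf hpos t) := by
  refine Integrable.of_bound measurable_bonus.aestronglyMeasurable 1
    (Filter.Eventually.of_forall fun q => ?_)
  have h := pulls_nonneg q.1.2 q.2.2.1
  rw [Real.norm_of_nonneg (by positivity)]
  exact div_le_self zero_le_one (by linarith)

/-- The expected bonus of the arm that is played, in terms of the optimal fair policy. -/
lemma integral_bonus :
    ∫ q, 1 / (1 + pulls q.1.2 q.2.2.1) ∂roundLaw K hf hpos t =
      ∫ p, exploration (fairPolicy f p.1) p.2 ∂jointLaw K hf hpos t := by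
  have m := measurePreserving_sampleLaw_sample (K := K) (t := t) hf hpos
  -- Matching replaces the optimal policy by the policy of the sample, from which the arm is drawn.
  rw [← integral_comp_of_measurePreserving m (measurable_exploration hf).aestronglyMeasurable,
    integral_eq_lintegral_of_nonneg_ae (Filter.Eventually.of_forall fun q =>
      div_nonneg zero_le_one (one_add_pulls_pos _ _).le) measurable_bonus.aestronglyMeasurable,
    integral_eq_lintegral_of_nonneg_ae (Filter.Eventually.of_forall fun q =>
      exploration_nonneg (fairPolicy_nonneg hpos _) _)
      ((measurable_exploration hf).comp m.measurable).aestronglyMeasurable,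
    lintegral_roundLaw_arm hf hpos
      (G := fun p a => ENNReal.ofReal (1 / (1 + pulls p.2 a)))]
  · congr 1
    refine lintegral_congr fun q => ?_
    rw [exploration, ENNReal.ofReal_sum_of_nonneg fun a _ =>
      div_nonneg (fairPolicy_nonneg hpos _ _) (one_add_pulls_pos _ _).le]
    refine Finset.sum_congr rfl fun a _ => ?_
    rw [← ENNReal.ofReal_mul (fairPolicy_nonneg hpos _ _), mul_one_div]
  · intro a
    have h : Measurable fun p : Params K × History K t => pulls p.2 a :=
      (measurable_pulls a).comp measurable_snd
    fun_prop

lemma integral_potential_succ_ge :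
    ∫ p, potential p.2 ∂jointLaw K hf hpos t +
        1 / 2 * ∫ p, exploration (fairPolicy f p.1) p.2 ∂jointLaw K hf hpos t ≤
      ∫ p, potential p.2 ∂jointLaw K hf hpos (t + 1) := by
  have m₁ := measurePreserving_roundLaw_fst (K := K) (t := t) hf hpos
  have m₂ := measurePreserving_roundLaw_snoc (K := K) (t := t) hf hpos
  have i₁ := m₁.integrable_comp_of_integrable (integrable_potential hf hpos)
  have i₂ := m₂.integrable_comp_of_integrable (integrable_potential hf hpos)
  have i₃ := (integrable_bonus (K := K) (t := t) hf hpos).const_mul (1 / 2)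
  rw [← integral_bonus,
    ← integral_comp_of_measurePreserving m₁ (integrable_potential hf hpos).aestronglyMeasurable,
    ← integral_comp_of_measurePreserving m₂ (integrable_potential hf hpos).aestronglyMeasurable,
    ← integral_const_mul]
  simp only [Function.comp_def] at i₁
  rw [← integral_add i₁ i₃]
  exact integral_mono (i₁.add i₃) i₂ fun q => potential_snoc_ge q.1.2 q.2

lemma integral_potential_le :
    ∫ p, potential p.2 ∂jointLaw K hf hpos t ≤ K * Real.log (1 + t) := by
  refine (integral_mono (integrable_potential hf hpos) (integrable_const _) fun p =>
    potential_le p.2).trans_eq ?_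
  simp

/-! ### Summation over rounds and choice of `η` -/

lemma integrable_roundRegret_roundLaw :
    Integrable (fun q => roundRegret f q.1.1 q.2.1) (roundLaw K hf hpos t) := by
  have hp := measurable_fairPolicy (K := K) hf
  have hm := measurable_roundRegret (K := K) hf
  have hg : Measurable fun q : (Params K × History K t) × (Fin K → ℝ) =>
      roundRegret f q.1.1 q.2 :=
    hm.comp (f := fun q : (Params K × History K t) × (Fin K → ℝ) => (q.1.1, q.2)) (by fun_prop)
  have h := (integrable_map_measure (μ := sampleLaw K hf hpos t)
    (f := fun q => (q.1, fairPolicy f q.2)) (g := fun q => roundRegret f q.1.1 q.2)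
    hg.aestronglyMeasurable (by fun_prop)).2 (integrable_roundRegret hf hpos)
  rw [← map_roundLaw_policy] at h
  exact (integrable_map_measure (μ := roundLaw K hf hpos t)
    (f := fun q => (q.1, q.2.1)) (g := fun q => roundRegret f q.1.1 q.2)
    hg.aestronglyMeasurable (by fun_prop)).1 h

lemma integral_roundRegret_roundLaw :
    ∫ q, roundRegret f q.1.1 q.2.1 ∂roundLaw K hf hpos t =
      ∫ q, roundRegret f q.1.1 (fairPolicy f q.2) ∂sampleLaw K hf hpos t := by
  have hp := measurable_fairPolicy (K := K) hf
  have hm := measurable_roundRegret (K := K) hf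
  have hg : Measurable fun q : (Params K × History K t) × (Fin K → ℝ) =>
      roundRegret f q.1.1 q.2 :=
    hm.comp (f := fun q : (Params K × History K t) × (Fin K → ℝ) => (q.1.1, q.2)) (by fun_prop)
  have h₁ := integral_map (μ := sampleLaw K hf hpos t) (φ := fun q => (q.1, fairPolicy f q.2))
    (f := fun q => roundRegret f q.1.1 q.2) (by fun_prop) hg.aestronglyMeasurable
  have h₂ := integral_map (μ := roundLaw K hf hpos t) (φ := fun q => (q.1, q.2.1))
    (f := fun q => roundRegret f q.1.1 q.2) (by fun_prop) hg.aestronglyMeasurable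
  rw [← h₁, ← h₂, map_roundLaw_policy]

lemma integrable_rewardRegret (T : ℕ) :
    Integrable (fun p => rewardRegret f p.1 p.2) (jointLaw K hf hpos T) := by
  induction T with
  | zero => simp [rewardRegret]
  | succ T ih =>
    have m₁ := measurePreserving_roundLaw_fst (K := K) (t := T) hf hpos
    have m₂ := measurePreserving_roundLaw_snoc (K := K) (t := T) hf hpos
    refine (m₂.integrable_comp (measurable_rewardRegret hf).aestronglyMeasurable).1 ?_
    simp only [Function.comp_def, rewardRegret_snoc]
    exact (m₁.integrable_comp_of_integrable ih).add (integrable_roundRegret_roundLaw hf hpos)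

lemma integral_rewardRegret_succ (T : ℕ) :
    ∫ p, rewardRegret f p.1 p.2 ∂jointLaw K hf hpos (T + 1) =
      ∫ p, rewardRegret f p.1 p.2 ∂jointLaw K hf hpos T +
        ∫ q, roundRegret f q.1.1 (fairPolicy f q.2) ∂sampleLaw K hf hpos T := by
  have m₁ := measurePreserving_roundLaw_fst (K := K) (t := T) hf hpos
  have m₂ := measurePreserving_roundLaw_snoc (K := K) (t := T) hf hpos
  have i₁ := m₁.integrable_comp_of_integrable (integrable_rewardRegret hf hpos T)
  rw [← integral_roundRegret_roundLaw,
    ← integral_comp_of_measurePreserving m₁ (measurable_rewardRegret hf).aestronglyMeasurable,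
    ← integral_comp_of_measurePreserving m₂ (measurable_rewardRegret hf).aestronglyMeasurable]
  simp only [rewardRegret_snoc]
  exact integral_add i₁ (integrable_roundRegret_roundLaw hf hpos)

lemma bayesRewardRegret_eq (T : ℕ) :
    bayesRewardRegret K f hf hpos T = ∫ p, rewardRegret f p.1 p.2 ∂jointLaw K hf hpos T :=
  (Measure.integral_compProd (integrable_rewardRegret hf hpos T)).symm

/-- The potential carries the factor `2 / η` so that half a bonus, its guaranteed increase, absorbs
the exploration term `1 / η` of the new round. -/
lemma abs_integral_rewardRegret_le {η : ℝ} (hη : 0 < η) (T : ℕ) :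
    |∫ p, rewardRegret f p.1 p.2 ∂jointLaw K hf hpos T| ≤
      4 * η * (Real.log K + √2) * T +
        2 / η * ∫ p, potential p.2 ∂jointLaw K hf hpos T := by
  induction T with
  | zero =>
    have h : 0 ≤ ∫ p, potential p.2 ∂jointLaw K hf hpos 0 :=
      integral_nonneg fun p => potential_nonneg _
    simp only [rewardRegret, Finset.univ_eq_empty, Finset.sum_empty, sub_self, integral_zero,
      abs_zero, CharP.cast_eq_zero, mul_zero, zero_add]
    positivity
  | succ T ih =>
    have h₁ := abs_integral_roundRegret_le (K := K) (t := T) hf hpos hη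
    have h₂ := mul_le_mul_of_nonneg_left (integral_potential_succ_ge (K := K) (t := T) hf hpos)
      (by positivity : 0 ≤ 2 / η)
    rw [integral_rewardRegret_succ]
    refine (abs_add_le _ _).trans ?_
    push_cast
    calc _ ≤ _ := add_le_add ih h₁
      _ = 4 * η * (Real.log K + √2) * (T + 1) + 2 / η *
          (∫ p, potential p.2 ∂jointLaw K hf hpos T +
        1 / 2 * ∫ p, exploration (fairPolicy f p.1) p.2 ∂jointLaw K hf hpos T) := by ring
      _ ≤ _ := by linarith

lemma abs_bayesRewardRegret_le {T : ℕ} (hT : 1 ≤ T) :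
    |bayesRewardRegret K f hf hpos T| ≤
      8 * √((K : ℝ) * T) * (1 + Real.log ((K : ℝ) * T)) := by
  have hK : (1 : ℝ) ≤ K := by exact_mod_cast Nat.one_le_iff_ne_zero.2 (NeZero.ne K)
  have hT' : (1 : ℝ) ≤ T := by exact_mod_cast hT
  have hT₀ : (0 : ℝ) < T := by linarith
  -- This choice of `η` makes both terms multiples of `√K * √T`, up to logarithms.
  have hη : 0 < √K / √T := by positivity
  have h₁ := abs_integral_rewardRegret_le (K := K) hf hpos hη T
  have h₂ := mul_le_mul_of_nonneg_left (integral_potential_le (K := K) (t := T) hf hpos)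
    (by positivity : 0 ≤ 2 / (√(K : ℝ) / √T))
  have hlog : Real.log (1 + T) ≤ 1 + Real.log T := by
    have h : Real.log (1 + T) ≤ Real.log (2 * T) := Real.log_le_log (by linarith) (by linarith)
    rw [Real.log_mul two_ne_zero hT₀.ne'] at h
    linarith [Real.log_two_lt_d9]
  have hsqrt : √2 ≤ 3 / 2 := Real.sqrt_le_iff.2 ⟨by norm_num, by norm_num⟩
  have hlK := Real.log_nonneg hK
  have hlT := Real.log_nonneg hT'
  rw [bayesRewardRegret_eq, Real.log_mul (by positivity) (by positivity),
    Real.sqrt_mul (by positivity)]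
  have e₁ : 4 * (√K / √T) * (Real.log K + √2) * T =
      √K * √T * (4 * (Real.log K + √2)) := by
    nth_rewrite 2 [← Real.mul_self_sqrt hT₀.le]
    field_simp
  have e₂ : 2 / (√(K : ℝ) / √T) * (K * Real.log (1 + T)) =
      √K * √T * (2 * Real.log (1 + T)) := by
    nth_rewrite 2 [← Real.mul_self_sqrt (by positivity : (0 : ℝ) ≤ K)]
    field_simp
  calc _ ≤ √K * √T * (4 * (Real.log K + √2)) + √K * √T * (2 * Real.log (1 + T)) := by
        linarith
    _ = √K * √T * (4 * (Real.log K + √2) + 2 * Real.log (1 + T)) := by ring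
    -- The constant is `8 = 4 * (3 / 2) + 2`, from `√2 ≤ 3 / 2` and `log (1 + T) ≤ 1 + log T`.
    _ ≤ √K * √T * (8 * (1 + (Real.log K + Real.log T))) :=
        mul_le_mul_of_nonneg_left (by linarith) (by positivity)
    _ = _ := by ring

end

end FairX

end

open MeasureTheory ProbabilityTheory in
/-- For every merit function and every number of arms, the Bayesian reward regret of FairX-TS
under the standard normal prior is `√(K T)` up to a universal constant and a power of the
logarithm of `K T`, at every round `T`; the regret is integrable, so the expectation is genuine. -/
theorem theorem7 :
    ∃ (C : ℝ) (p : ℕ), 0 < C ∧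
      ∀ (K : ℕ) [NeZero K] (f : ℝ → ℝ) (hf : Measurable f) (hpos : ∀ x, 0 < f x)
        (T : ℕ), 1 ≤ T →
        Integrable
          (fun q : FairX.Params K × FairX.History K T => FairX.rewardRegret f q.1 q.2)
          (FairX.prior K ⊗ₘ FairX.historyKernel K f hf hpos T) ∧
        |FairX.bayesRewardRegret K f hf hpos T| ≤
          C * Real.sqrt ((K : ℝ) * T) * (1 + Real.log ((K : ℝ) * T)) ^ p := by
  refine ⟨8, 1, by norm_num, fun K _ f hf hpos T hT =>
    ⟨FairX.integrable_rewardRegret hf hpos T, ?_⟩⟩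
  rw [pow_one]
  exact FairX.abs_bayesRewardRegret_le hf hpos hT
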